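/- Let $M$ be a (Hausdorff, finite-dimensional) smooth manifold with a twisted Poisson structure $(\Lambda,\varphi)$: $\Lambda$ is a bivector field and $\varphi$ a closed $3$-form with $\tfrac12[\Lambda,\Lambda]=\Lambda^{\sharp}(\varphi)$. Here $\Lambda^\sharp:\Gamma(T^*M)\to\Gamma(TM)$ is given by $\langle\beta,\Lambda^\sharp\alpha\rangle=\Lambda(\alpha,\beta)$ and extended to $k$-forms by $\Lambda^\sharp(\eta)(\alpha_1,\dots,\alpha_k)=(-1)^k\eta(\Lambda^\sharp\alpha_1,\dots,\Lambda^\sharp\alpha_k)$, and the sign convention of the Schouten bracket $[\cdot,\cdot]$ is such that $\tfrac12[\Lambda,\Lambda](df,dg,dh)=\{f,\{g,h\}\}+\{g,\{h,f\}\}+\{h,\{f,g\}\}$ with $\{f,g\}=\Lambda(df,dg)$. Let $$\{\alpha,\beta\}^\varphi=\mathcal L_{\Lambda^\sharp\alpha}\beta-\mathcal L_{\Lambda^\sharp\beta}\alpha-d(\Lambda(\alpha,\beta))+\varphi(\Lambda^\sharp\alpha,\Lambda^\sharp\beta,\cdot)$$ be the induced bracket on $1$-forms, let $\partial_\varphi$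 be the differential on multivector fields determined by the bracket $\{\cdot,\cdot\}^\varphi$ and the anchor $\Lambda^\sharp$, let $H^2_{L-tP}(M)$ be its second cohomology with classes denoted $[\cdot]^\varphi$, and let $\Lambda^\sharp:H^2_{dR}(M,\mathbb R)\to H^2_{L-tP}(M)$, $[\eta]\mapsto[\Lambda^\sharp\eta]^\varphi$, be the induced homomorphism. Let $K\to M$ be a smooth complex line bundle with a Hermitian metric $h$, let $\nabla$ be a connection on $K$ compatible with $h$, and put $D_\alpha=\nabla_{\Lambda^\sharp\alpha}$ for $\alpha\in\Gamma(T^*M)$. The first real Chern class $c_1(K,\mathbb R)\in H^2_{dR}(M,\mathbb R)$ is the class, independent of all choices, of $\frac{i}{2\pi}\Omega$, where $\Omega$ is the curvature form of any connection on $K$ that is compatible with some Hermitian metric. Then $D$ is a contravariant derivative ($D_{f\alpha}=fD_\alpha$ and $D_\alpha(fs)=fD_\alpha s+(\Lambda^\sharp(\alpha)f)s$ for $f\in C^\infty(M,\mathbb R)$) compatible with $h$, i.e. $\Lambda^\sharp(\alpha)(h(s_1,s_2))=h(D_\alpha s_1,s_2)+h(s_1,D_\alpha s_2)$. There is a complex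 bivector field $\Pi$ on $M$ with $$\bigl(D_\alpha D_\beta-D_\beta D_\alpha-D_{\{\alpha,\beta\}^\varphi}\bigr)s=\Pi(\alpha,\beta)\,s\qquad\text{for all }\alpha,\beta\in\Gamma(T^*M),\ s\in\Gamma(K),$$ any such $\Pi$ is purely imaginary, the real bivector field $\frac{i}{2\pi}\Pi$ lies in the kernel of $\partial_\varphi$, and $$\Lambda^\sharp\bigl(c_1(K,\mathbb R)\bigr)=\Bigl[\frac{i}{2\pi}\Pi\Bigr]^\varphi .$$ -/

import Mathlib

open scoped Manifold ContDiff Topology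
open Bundle

noncomputable section

namespace TwistedPoisson

/-! ### The complex of a Lie algebroid -/

section Cohomology

variable {A L : Type*} [CommRing A] [Algebra ℝ A] [AddCommGroup L] [Module A L]

/-- The differential determined by an anchor `ρ` and a bracket `[·,·]` on `L`,
`(d P)(a_0, …, a_{k+1}) = ∑_i (-1)^i ρ(a_i) (P(a_0, …, â_i, …, a_{k+1}))`
`  + ∑_{i<j} (-1)^{i+j} P([a_i, a_j], a_0, …, â_i, …, â_j, …, a_{k+1})`,
where `P` has degree `k + 1`. In the code the pair `i ≤ j` of the second sum stands for the pair
`i < j + 1` of the formula, which accounts for the minus sign. -/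
def koszulDiff (ρ : L → A →ₗ[ℝ] A) (br : L → L → L) (k : ℕ) :
    (L [⋀^Fin (k + 1)]→ₗ[A] A) →ₗ[ℝ] ((Fin (k + 2) → L) → A) where
  toFun P a :=
    (∑ i : Fin (k + 2), (-1) ^ (i : ℕ) * ρ (a i) (P (i.removeNth a))) -
      ∑ i : Fin (k + 1), ∑ j ∈ Finset.Ici i, (-1) ^ (i + j : ℕ) *
        P (Matrix.vecCons (br (a i.castSucc) (a j.succ)) (j.removeNth (i.castSucc.removeNth a)))
  map_add' P Q := by
    funext a
    simp only [AlternatingMap.add_apply, map_add, mul_add, Finset.sum_add_distrib, Pi.add_apply]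
    ring
  map_smul' c P := by
    funext a
    simp only [AlternatingMap.smul_apply, map_smul, mul_smul_comm, ← Finset.smul_sum,
      ← smul_sub, Pi.smul_apply, RingHom.id_apply]

/-- The cochains `P` of degree `k + 1` with `d P = 0`. -/
def cocycles (ρ : L → A →ₗ[ℝ] A) (br : L → L → L) (k : ℕ) :
    Submodule ℝ (L [⋀^Fin (k + 1)]→ₗ[A] A) :=
  LinearMap.ker (koszulDiff ρ br k)

/-- The underlying function of a cochain. -/
def cochainFun (k : ℕ) : (L [⋀^Fin k]→ₗ[A] A) →ₗ[ℝ] ((Fin k → L) → A) where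
  toFun P := P
  map_add' P Q := by funext a; simp
  map_smul' c P := by funext a; simp

/-- The cochains of degree `k + 2` of the form `d Q`. -/
def coboundaries (ρ : L → A →ₗ[ℝ] A) (br : L → L → L) (k : ℕ) :
    Submodule ℝ (L [⋀^Fin (k + 2)]→ₗ[A] A) :=
  (LinearMap.range (koszulDiff ρ br k)).comap (cochainFun (k + 2))

instance (ρ : L → A →ₗ[ℝ] A) (br : L → L → L) (k : ℕ) : AddCommGroup (cocycles ρ br k) :=
  Submodule.addCommGroup _

/-- The cohomology in degree `k + 2`. -/
abbrev Cohomology (ρ : L → A →ₗ[ℝ] A) (br : L → L → L) (k : ℕ) : Type _ :=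
  cocycles ρ br (k + 1) ⧸ (coboundaries ρ br k).submoduleOf (cocycles ρ br (k + 1))

variable {L' : Type*} [AddCommGroup L'] [Module A L']

/-- The map `(T^♯ η)(a_1, …, a_k) = (-1)^k η(T a_1, …, T a_k)`. -/
def signedPullback (T : L' →ₗ[A] L) (k : ℕ) :
    (L [⋀^Fin k]→ₗ[A] A) →ₗ[ℝ] (L' [⋀^Fin k]→ₗ[A] A) where
  toFun η := ((-1 : A) ^ k) • η.compLinearMap T
  map_add' η ξ := by ext a; simp
  map_smul' c η := by ext a; simp

theorem signedPullback_apply (T : L' →ₗ[A] L) (k : ℕ) (η : L [⋀^Fin k]→ₗ[A] A)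
    (a : Fin k → L') : signedPullback T k η a = (-1) ^ k * η (fun i => T (a i)) := rfl

variable {ρ : L → A →ₗ[ℝ] A} {br : L → L → L} {ρ' : L' → A →ₗ[ℝ] A} {br' : L' → L' → L'}

theorem koszulDiff_signedPullback (T : L' →ₗ[A] L) (hρ : ∀ a, ρ' a = ρ (T a))
    (hbr : ∀ a b, T (br' a b) = br (T a) (T b)) (k : ℕ) (η : L [⋀^Fin (k + 1)]→ₗ[A] A)
    (a : Fin (k + 2) → L') :
    koszulDiff ρ' br' k (signedPullback T (k + 1) η) a =
      (-1) ^ (k + 1) * koszulDiff ρ br k η (fun i => T (a i)) := by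
  have hc : ∀ (u : L') (v : Fin k → L'), (fun i => T (Matrix.vecCons u v i)) =
      Matrix.vecCons (T u) (fun i => T (v i)) := by
    intro u v
    funext i
    refine Fin.cases ?_ (fun j => ?_) i <;> simp
  have hsign : ∀ (u : L) (f : A), ρ u ((-1) ^ (k + 1) * f) = (-1) ^ (k + 1) * ρ u f := by
    intro u f
    rcases neg_one_pow_eq_or A (k + 1) with h | h <;> simp [h]
  simp only [koszulDiff, LinearMap.coe_mk, AddHom.coe_mk, signedPullback_apply, hc, hbr, hρ,
    hsign, mul_sub, Finset.mul_sum]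
  congr 1
  · refine Finset.sum_congr rfl fun i _ => ?_
    rw [mul_left_comm]; rfl
  · refine Finset.sum_congr rfl fun i _ => Finset.sum_congr rfl fun j _ => ?_
    rw [mul_left_comm]; rfl

/-- The map induced in cohomology by `T^♯`, when `T` preserves anchors and brackets. -/
def cohomologyMap (T : L' →ₗ[A] L) (hρ : ∀ a, ρ' a = ρ (T a))
    (hbr : ∀ a b, T (br' a b) = br (T a) (T b)) (k : ℕ) :
    Cohomology ρ br k →ₗ[ℝ] Cohomology ρ' br' k :=
  Submodule.mapQ _ _
    ((signedPullback T (k + 2)).restrict (p := cocycles ρ br (k + 1))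
      (q := cocycles ρ' br' (k + 1)) fun η hη => by
        refine LinearMap.mem_ker.2 (funext fun a => ?_)
        rw [koszulDiff_signedPullback T hρ hbr, LinearMap.mem_ker.1 hη]
        exact mul_zero _)
    (by
      rintro ⟨η, hη⟩ h
      obtain ⟨ξ, hξ⟩ : ∃ ξ, koszulDiff ρ br k ξ = η := h
      refine ⟨-signedPullback T (k + 1) ξ, funext fun a => ?_⟩
      have h := congrFun hξ (fun i => T (a i))
      change koszulDiff ρ br k ξ (fun i => T (a i)) = η (fun i => T (a i)) at h
      change _ = signedPullback T (k + 2) η a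
      rw [map_neg, Pi.neg_apply, koszulDiff_signedPullback T hρ hbr, signedPullback_apply, h]
      ring)

end Cohomology

/-! ### Smooth functions, vector fields and differential forms -/

section Calculus

variable (E : Type*) [NormedAddCommGroup E] [NormedSpace ℝ E]
  (M : Type*) [TopologicalSpace M] [ChartedSpace E M]

/-- The ring `C^∞(M, ℝ)`. -/
abbrev Fun : Type _ := C^∞⟮𝓘(ℝ, E), M; 𝓘(ℝ, ℝ), ℝ⟯

/-- The space `C^∞(M, ℂ)` of complex valued smooth functions. -/
abbrev CFun : Type _ := C^∞⟮𝓘(ℝ, E), M; 𝓘(ℝ, ℂ), ℂ⟯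

section SectionModule

variable {E M}
theorem fun_sum_apply {n : ℕ} (f : Fin n → Fun E M) (x : M) :
    (∑ i, f i) x = ∑ i, f i x :=
  map_sum ((Pi.evalAddMonoidHom (fun _ : M => ℝ) x).comp
    (ContMDiffMap.coeFnAddMonoidHom (I := 𝓘(ℝ, E)) (I' := 𝓘(ℝ, ℝ)) (n := ∞))) f Finset.univ

variable {F : Type*} [NormedAddCommGroup F] [NormedSpace ℝ F]
  {V : M → Type*} [TopologicalSpace (TotalSpace F V)]
  [∀ x, AddCommGroup (V x)] [∀ x, Module ℝ (V x)] [∀ x : M, TopologicalSpace (V x)]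
  [FiberBundle F V] [VectorBundle ℝ F V]

/-- Smooth functions act pointwise on the smooth sections of a real vector bundle. -/
instance sectionModule : Module (Fun E M) Cₛ^∞⟮𝓘(ℝ, E); F, V⟯ where
  smul f s := ⟨fun x => f x • s x, f.contMDiff.smul_section s.contMDiff⟩
  one_smul s := by ext x; exact one_smul ℝ (s x)
  mul_smul f g s := by ext x; exact mul_smul (f x) (g x) (s x)
  smul_zero f := by ext x; exact smul_zero (f x)
  smul_add f s t := by ext x; exact smul_add (f x) (s x) (t x)
  add_smul f g s := by ext x; exact add_smul (f x) (g x) (s x)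
  zero_smul s := by ext x; exact zero_smul ℝ (s x)

@[simp] theorem section_smul_apply (f : Fun E M) (s : Cₛ^∞⟮𝓘(ℝ, E); F, V⟯) (x : M) :
    (f • s) x = f x • s x := rfl

end SectionModule

variable [IsManifold 𝓘(ℝ, E) ∞ M]

/-- The space `Γ(TM)` of smooth vector fields. -/
abbrev VField : Type _ := Cₛ^∞⟮𝓘(ℝ, E); E, (TangentSpace 𝓘(ℝ, E) : M → Type _)⟯

/-- The space `Γ(T^*M)` of smooth `1`-forms, as `C^∞(M, ℝ)`-linear maps `Γ(TM) → C^∞(M, ℝ)`. -/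
abbrev OneForm : Type _ := VField E M →ₗ[Fun E M] Fun E M

/-- The space `Γ(⋀^k T^*M)` of smooth `k`-forms, as alternating `C^∞(M, ℝ)`-multilinear maps on
`Γ(TM)`. -/
abbrev Form (k : ℕ) : Type _ := VField E M [⋀^Fin k]→ₗ[Fun E M] Fun E M

/-- The space `Γ(⋀^k TM)` of smooth `k`-vector fields, as alternating `C^∞(M, ℝ)`-multilinear maps
on `Γ(T^*M)`. -/
abbrev MultiVector (k : ℕ) : Type _ := OneForm E M [⋀^Fin k]→ₗ[Fun E M] Fun E M

/-- Smooth complex valued `k`-forms. -/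
abbrev CForm (k : ℕ) : Type _ := VField E M [⋀^Fin k]→ₗ[Fun E M] CFun E M

/-- Smooth complex `k`-vector fields. -/
abbrev CMultiVector (k : ℕ) : Type _ := OneForm E M [⋀^Fin k]→ₗ[Fun E M] CFun E M

variable {E M}

/-- The derivative `X(g)` of a smooth (vector valued) function `g` along a vector field `X`. -/
def act {W : Type*} [NormedAddCommGroup W] [NormedSpace ℝ W] (X : VField E M) :
    C^∞⟮𝓘(ℝ, E), M; 𝓘(ℝ, W), W⟯ →ₗ[ℝ] C^∞⟮𝓘(ℝ, E), M; 𝓘(ℝ, W), W⟯ where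
  toFun g := ⟨fun x => mvfderiv 𝓘(ℝ, E) g x (X x), by
    have h1 := g.contMDiff.contMDiff_tangentMap (m := ∞) (by simp)
    have h2 := h1.comp X.contMDiff
    have h3 := (contMDiff_snd_tangentBundle_modelSpace W 𝓘(ℝ, W) (n := ∞)).comp h2
    exact h3⟩
  map_add' f g := by
    ext x
    exact DFunLike.congr_fun (mvfderiv_add f.mdifferentiableAt g.mdifferentiableAt) (X x)
  map_smul' c g := by
    ext x
    have h := mvfderiv_smul (x := x) (a := fun _ : M => c)
      (mdifferentiable_const (I := 𝓘(ℝ, E)) (I' := 𝓘(ℝ, ℝ)) x) (g.mdifferentiableAt (x := x))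
    have h' := DFunLike.congr_fun h (X x)
    rw [mvfderiv_const] at h'
    exact h'.trans (add_eq_left.2 (zero_smul ℝ (g x)))

theorem act_apply {W : Type*} [NormedAddCommGroup W] [NormedSpace ℝ W] (X : VField E M)
    (g : C^∞⟮𝓘(ℝ, E), M; 𝓘(ℝ, W), W⟯) (x : M) :
    act X g x = mvfderiv 𝓘(ℝ, E) g x (X x) := rfl

theorem act_mul (X : VField E M) (f g : Fun E M) :
    act X (f * g) = f * act X g + g * act X f := by
  ext x
  exact DFunLike.congr_fun (mvfderiv_mul f.mdifferentiableAt g.mdifferentiableAt) (X x)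

theorem act_add_left {W : Type*} [NormedAddCommGroup W] [NormedSpace ℝ W] (X Y : VField E M)
    (g : C^∞⟮𝓘(ℝ, E), M; 𝓘(ℝ, W), W⟯) : act (X + Y) g = act X g + act Y g := by
  ext x
  exact map_add (mvfderiv 𝓘(ℝ, E) g x) (X x) (Y x)

theorem act_smul_left {W : Type*} [NormedAddCommGroup W] [NormedSpace ℝ W] (f : Fun E M)
    (X : VField E M) (g : C^∞⟮𝓘(ℝ, E), M; 𝓘(ℝ, W), W⟯) : act (f • X) g = f • act X g := by
  ext x
  exact map_smul (mvfderiv 𝓘(ℝ, E) g x) (f x) (X x)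

theorem vfield_sum_apply {n : ℕ} (Y : Fin n → VField E M) (x : M) :
    (∑ i, Y i) x = ∑ i, Y i x :=
  map_sum ((Pi.evalAddMonoidHom _ x).comp
    (ContMDiffSection.coeAddHom 𝓘(ℝ, E) E ∞ (TangentSpace 𝓘(ℝ, E) : M → Type _))) Y Finset.univ

variable [FiniteDimensional ℝ E]

/-- The Lie bracket `[X, Y]` of smooth vector fields. -/
def bracket (X Y : VField E M) : VField E M :=
  ⟨VectorField.mlieBracket 𝓘(ℝ, E) X Y, by
    have := FiniteDimensional.complete ℝ E
    have : IsManifold 𝓘(ℝ, E) (((⊤ : ℕ∞) : WithTop ℕ∞) + 1) M := by simpa using ‹_›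
    have : IsManifold 𝓘(ℝ, E) (minSmoothness ℝ 2) M := by
      rw [minSmoothness_of_isRCLikeNormedField]; infer_instance
    exact ContDiff.mlieBracket_vectorField (m := ⊤) (n := ⊤) X.contMDiff Y.contMDiff (by simp)⟩

theorem bracket_add_right (X Y Z : VField E M) :
    bracket X (Y + Z) = bracket X Y + bracket X Z := by
  have := FiniteDimensional.complete ℝ E
  ext x
  exact VectorField.mlieBracket_add_right Y.mdifferentiableAt Z.mdifferentiableAt

theorem bracket_smul_right (X Y : VField E M) (f : Fun E M) :
    bracket X (f • Y) = act X f • Y + f • bracket X Y := by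
  have := FiniteDimensional.complete ℝ E
  ext x
  exact VectorField.mlieBracket_smul_right f.mdifferentiableAt Y.mdifferentiableAt

theorem bracket_swap (X Y : VField E M) : bracket X Y = -bracket Y X := by
  ext x
  exact VectorField.mlieBracket_swap_apply

/-- The differential `df` of a smooth function. -/
def dFun (f : Fun E M) : OneForm E M where
  toFun X := act X f
  map_add' X Y := act_add_left X Y f
  map_smul' g X := act_smul_left g X f

/-- The Lie derivative `L_X β`. -/
def lieDeriv (X : VField E M) (β : OneForm E M) : OneForm E M where
  toFun Y := act X (β Y) - β (bracket X Y)
  map_add' Y Z := by rw [map_add, map_add, bracket_add_right, map_add]; ring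
  map_smul' f Y := by
    rw [map_smul, smul_eq_mul, act_mul, bracket_smul_right, map_add, map_smul, map_smul]
    simp only [smul_eq_mul, RingHom.id_apply]
    ring

/-! ### Vector fields are determined by their pairings with one-forms -/

variable [T2Space M]

/-- A family of one-forms and vector fields which is a dual frame near a given point. -/
theorem exists_dual_frame (x₀ : M) :
    ∃ (n : ℕ) (ψ : Fun E M) (θ : Fin n → OneForm E M) (Y : Fin n → VField E M),
      (∀ᶠ x in 𝓝 x₀, ψ x = 1) ∧ (∀ X : VField E M, (ψ * ψ) • X = ∑ i, θ i X • Y i) ∧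
      (∀ i (X X' : VField E M) x, X x = X' x → θ i X x = θ i X' x) := by
  let e := trivializationAt E (TangentSpace 𝓘(ℝ, E) : M → Type _) x₀
  let b := Module.finBasis ℝ E
  have hx₀ : x₀ ∈ e.baseSet := FiberBundle.mem_baseSet_trivializationAt _ _ x₀
  obtain ⟨ψ, -, hψ⟩ := (SmoothBumpFunction.nhds_basis_tsupport (I := 𝓘(ℝ, E)) x₀).mem_iff.1
    (e.open_baseSet.mem_nhds hx₀)
  have hψs : ContMDiff 𝓘(ℝ, E) 𝓘(ℝ, ℝ) ∞ ψ := ψ.contMDiff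
  have hoff : ∀ x, x ∉ e.baseSet → ψ x = 0 := fun x hx =>
    image_eq_zero_of_notMem_tsupport fun h => hx (hψ h)
  have hθs : ∀ (i) (X : VField E M), ContMDiff 𝓘(ℝ, E) 𝓘(ℝ, ℝ) ∞
      (fun x => ψ x * e.localFrameCoeff 𝓘(ℝ, E) b i x (X x)) := by
    intro i X
    refine contMDiff_of_tsupport fun x hx => ?_
    have hx' : x ∈ e.baseSet := hψ (tsupport_mul_subset_left hx)
    exact (hψs x).mul (contMDiffAt_localFrameCoeff b hx' (X.contMDiff x) i)
  refine ⟨_, ⟨ψ, hψs⟩,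
    fun i =>
      { toFun := fun X => ⟨_, hθs i X⟩
        map_add' := fun X Y => ?_
        map_smul' := fun f X => ?_ },
    fun i => ⟨_, ContMDiffOn.smul_section_of_tsupport (hψs.contMDiffOn) e.open_baseSet hψ
      (Trivialization.contMDiffOn_localFrame_baseSet (I := 𝓘(ℝ, E)) ∞ e b i)⟩,
    ψ.eventuallyEq_one, fun X => ?_, fun i X X' x h => ?_⟩
  · ext x
    change ψ x * _ = ψ x * _ + ψ x * _
    rw [← mul_add, ← map_add]; rfl
  · ext x
    change ψ x * e.localFrameCoeff 𝓘(ℝ, E) b i x (f x • X x) = f x * (ψ x * _)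
    rw [map_smul, smul_eq_mul]; ring
  · ext x
    rw [vfield_sum_apply]
    change (ψ x * ψ x) • X x = ∑ i, (ψ x * _) • (ψ x • e.localFrame b i x)
    by_cases hx : x ∈ e.baseSet
    · nth_rewrite 1 [Trivialization.eq_sum_localFrameCoeff_smul (I := 𝓘(ℝ, E)) (b := b) (s := X) hx]
      rw [Finset.smul_sum]
      refine Finset.sum_congr rfl fun i _ => ?_
      rw [smul_smul, smul_smul]
      congr 1
      ring
    · simp [hoff x hx]
  · change ψ x * _ = ψ x * _
    rw [h]

theorem vfield_ext (X X' : VField E M) (x : M) (h : ∀ β : OneForm E M, β X x = β X' x) :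
    X x = X' x := by
  obtain ⟨n, ψ, θ, Y, hψ, hY, -⟩ := exists_dual_frame (E := E) x
  have key : ∀ Z : VField E M, Z x = ∑ i, θ i Z x • Y i x := by
    intro Z
    have h1 := congrArg (fun W : VField E M => W x) (hY Z)
    simp only [vfield_sum_apply] at h1
    change (ψ x * ψ x) • Z x = _ at h1
    rw [hψ.self_of_nhds, mul_one, one_smul] at h1
    exact h1
  rw [key X, key X']
  simp only [h]

theorem oneForm_congr (β : OneForm E M) (X X' : VField E M) (x : M) (h : X x = X' x) :
    β X x = β X' x := by
  obtain ⟨n, ψ, θ, Y, hψ, hY, hθ⟩ := exists_dual_frame (E := E) x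
  have key : ∀ Z : VField E M, β Z x = ∑ i, θ i Z x * β (Y i) x := by
    intro Z
    have h1 := congrArg (fun f : Fun E M => f x) (congrArg β (hY Z))
    simp only [map_smul, map_sum, fun_sum_apply] at h1
    change ψ x * ψ x * β Z x = _ at h1
    rw [hψ.self_of_nhds, mul_one, one_mul] at h1
    exact h1
  rw [key X, key X']
  simp only [hθ _ X X' x h]

/-- Every `C^∞(M, ℝ)`-linear form on `Γ(T^*M)` is the pairing with a unique vector field. -/
theorem existsUnique_vfield (Φ : OneForm E M →ₗ[Fun E M] Fun E M) :
    ∃! X : VField E M, ∀ β : OneForm E M, β X = Φ β := by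
  choose n ψ θ Y hψ hY hθ using fun x₀ : M => exists_dual_frame (E := E) x₀
  let Z : M → VField E M := fun x₀ => ∑ i, Φ (θ x₀ i) • Y x₀ i
  have hZ : ∀ x₀ (β : OneForm E M), β (Z x₀) = (ψ x₀ * ψ x₀) * Φ β := by
    intro x₀ β
    have h1 : (ψ x₀ * ψ x₀) • β = ∑ i, β (Y x₀ i) • θ x₀ i := by
      refine LinearMap.ext fun X => ?_
      have h2 := congrArg β (hY x₀ X)
      rw [map_smul, map_sum] at h2
      rw [LinearMap.smul_apply, h2, LinearMap.sum_apply]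
      refine Finset.sum_congr rfl fun i _ => ?_
      rw [map_smul, LinearMap.smul_apply, smul_eq_mul, smul_eq_mul, mul_comm]
    have h3 := congrArg Φ h1
    rw [map_smul, map_sum, smul_eq_mul] at h3
    rw [h3, map_sum]
    refine Finset.sum_congr rfl fun i _ => ?_
    rw [map_smul, map_smul, smul_eq_mul, smul_eq_mul, mul_comm]
  have hZZ : ∀ x₀ x, ψ x₀ x = 1 → Z x₀ x = Z x x := by
    intro x₀ x hx
    refine vfield_ext _ _ x fun β => ?_
    rw [hZ, hZ]
    change ψ x₀ x * ψ x₀ x * Φ β x = ψ x x * ψ x x * Φ β x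
    rw [hx, (hψ x).self_of_nhds]
  let X : VField E M := ⟨fun x => Z x x, fun x₀ => by
    refine ((Z x₀).contMDiff x₀).congr_of_eventuallyEq ?_
    filter_upwards [hψ x₀] with x hx
    rw [hZZ x₀ x hx]⟩
  refine ⟨X, fun β => ?_, fun X' hX' => ?_⟩
  · ext x
    rw [oneForm_congr β X (Z x) x rfl, hZ]
    change ψ x x * ψ x x * Φ β x = Φ β x
    rw [(hψ x).self_of_nhds]; ring
  · ext x
    refine vfield_ext _ _ x fun β => ?_
    rw [hX', oneForm_congr β X (Z x) x rfl, hZ]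
    change Φ β x = ψ x x * ψ x x * Φ β x
    rw [(hψ x).self_of_nhds]; ring

/-! ### Bivector fields and twisted Poisson structures -/

section Poisson

theorem alt_two_add_right {A L B : Type*} [CommRing A] [AddCommGroup L] [Module A L]
    [AddCommGroup B] [Module A B] (P : L [⋀^Fin 2]→ₗ[A] B) (a b b' : L) :
    P ![a, b + b'] = P ![a, b] + P ![a, b'] :=
  (P.curryLeft a).map_vecCons_add ![] b b'

theorem alt_two_smul_right {A L B : Type*} [CommRing A] [AddCommGroup L] [Module A L]
    [AddCommGroup B] [Module A B] (P : L [⋀^Fin 2]→ₗ[A] B) (a b : L) (f : A) :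
    P ![a, f • b] = f • P ![a, b] :=
  (P.curryLeft a).map_vecCons_smul ![] f b

theorem alt_two_swap {A L B : Type*} [CommRing A] [AddCommGroup L] [Module A L]
    [AddCommGroup B] [Module A B] (P : L [⋀^Fin 2]→ₗ[A] B) (a b : L) :
    P ![a, b] = -P ![b, a] := by
  rw [← P.map_swap ![b, a] (i := 0) (j := 1) (by simp)]
  congr 1
  funext i
  fin_cases i <;> rfl

/-- The linear form `β ↦ Λ(α, β)`. -/
def pairing (Λ : MultiVector E M 2) (α : OneForm E M) : OneForm E M →ₗ[Fun E M] Fun E M where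
  toFun β := Λ ![α, β]
  map_add' := alt_two_add_right Λ α
  map_smul' f β := alt_two_smul_right Λ α β f

/-- The map `Λ^♯ : Γ(T^*M) → Γ(TM)`, characterized by `⟨β, Λ^♯ α⟩ = Λ(α, β)`. -/
def sharp (Λ : MultiVector E M 2) : OneForm E M →ₗ[Fun E M] VField E M where
  toFun α := (existsUnique_vfield (pairing Λ α)).choose
  map_add' α α' := by
    refine (existsUnique_vfield (pairing Λ (α + α'))).unique
      (existsUnique_vfield (pairing Λ (α + α'))).choose_spec.1 fun β => ?_
    rw [map_add, (existsUnique_vfield (pairing Λ α)).choose_spec.1,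
      (existsUnique_vfield (pairing Λ α')).choose_spec.1]
    exact (Λ.map_vecCons_add ![β] α α').symm
  map_smul' f α := by
    refine (existsUnique_vfield (pairing Λ (f • α))).unique
      (existsUnique_vfield (pairing Λ (f • α))).choose_spec.1 fun β => ?_
    rw [RingHom.id_apply, map_smul, (existsUnique_vfield (pairing Λ α)).choose_spec.1]
    exact (Λ.map_vecCons_smul ![β] f α).symm

theorem apply_sharp (Λ : MultiVector E M 2) (α β : OneForm E M) :
    β (sharp Λ α) = Λ ![α, β] :=
  (existsUnique_vfield (pairing Λ α)).choose_spec.1 β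

/-- The extension of `Λ^♯` to `k`-forms,
`(Λ^♯ η)(α_1, …, α_k) = (-1)^k η(Λ^♯ α_1, …, Λ^♯ α_k)`. -/
def sharpForm (Λ : MultiVector E M 2) (k : ℕ) : Form E M k →ₗ[ℝ] MultiVector E M k :=
  signedPullback (sharp Λ) k

/-- The Koszul bracket `{α, β} = L_{Λ^♯ α} β - L_{Λ^♯ β} α - d(Λ(α, β))`. -/
def koszulBracket (Λ : MultiVector E M 2) (α β : OneForm E M) : OneForm E M :=
  lieDeriv (sharp Λ α) β - lieDeriv (sharp Λ β) α - dFun (Λ ![α, β])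

/-- The one-form `φ(X, Y, ·)`. -/
def contract (φ : Form E M 3) (X Y : VField E M) : OneForm E M where
  toFun Z := φ ![X, Y, Z]
  map_add' := alt_two_add_right (φ.curryLeft X) Y
  map_smul' f Z := alt_two_smul_right (φ.curryLeft X) Y Z f

/-- The twisted bracket `{α, β}^φ = {α, β} + φ(Λ^♯ α, Λ^♯ β, ·)`. -/
def twistedBracket (Λ : MultiVector E M 2) (φ : Form E M 3) (α β : OneForm E M) : OneForm E M :=
  koszulBracket Λ α β + contract φ (sharp Λ α) (sharp Λ β)

/-- The value `[P, Q](α, β, γ)` of the Schouten bracket of two bivector fields,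
`[P, Q](α, β, γ) = ∑_cyc (⟨L_{P^♯ α} β, Q^♯ γ⟩ + ⟨L_{Q^♯ α} β, P^♯ γ⟩)`. On differentials it is
`[P, Q](df, dg, dh) = ∑_cyc (P(df, d(Q(dg, dh))) + Q(df, d(P(dg, dh))))`, so that
`(1/2) [Λ, Λ](df, dg, dh)` is the sum `{f, {g, h}} + {g, {h, f}} + {h, {f, g}}`. -/
def schouten (P Q : MultiVector E M 2) (α β γ : OneForm E M) : Fun E M :=
  (lieDeriv (sharp P α) β (sharp Q γ) + lieDeriv (sharp P β) γ (sharp Q α) +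
    lieDeriv (sharp P γ) α (sharp Q β)) +
  (lieDeriv (sharp Q α) β (sharp P γ) + lieDeriv (sharp Q β) γ (sharp P α) +
    lieDeriv (sharp Q γ) α (sharp P β))

variable (E M) in
/-- The de Rham differential `d` on `(k+1)`-forms. -/
abbrev deRhamDiff (k : ℕ) : Form E M (k + 1) →ₗ[ℝ] ((Fin (k + 2) → VField E M) → Fun E M) :=
  koszulDiff (fun X : VField E M => act (W := ℝ) X) bracket k

variable (E M) in
/-- A twisted Poisson structure: a bivector field `Λ` and a closed `3`-form `φ` with
`(1/2) [Λ, Λ] = Λ^♯ φ`. -/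
structure TwistedPoissonStructure where
  /-- The bivector field. -/
  Λ : MultiVector E M 2
  /-- The background `3`-form. -/
  φ : Form E M 3
  closed : deRhamDiff E M 2 φ = 0
  half_schouten : ∀ α β γ : OneForm E M,
    (1 / 2 : ℝ) • schouten Λ Λ α β γ = sharpForm Λ 3 φ ![α, β, γ]

variable (E M) in
/-- Closed `2`-forms. -/
abbrev ClosedForm : Submodule ℝ (Form E M 2) :=
  cocycles (fun X : VField E M => act (W := ℝ) X) bracket 1

variable (E M) in
/-- The second de Rham cohomology `H²_dR(M, ℝ)`. -/
abbrev HdR : Type _ := Cohomology (fun X : VField E M => act (W := ℝ) X) bracket 0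

/-- The de Rham class of a closed `2`-form. -/
def deRhamClass (η : ClosedForm E M) : HdR E M := Submodule.Quotient.mk η

namespace TwistedPoissonStructure

variable (P : TwistedPoissonStructure E M)

/-- The anchor, `α ↦ (f ↦ (Λ^♯ α)(f))`. -/
def anchor (α : OneForm E M) : Fun E M →ₗ[ℝ] Fun E M := act (sharp P.Λ α)

/-- The Lie bracket `{·,·}^φ` on one-forms. -/
def bracketφ (α β : OneForm E M) : OneForm E M := twistedBracket P.Λ P.φ α β

/-- The operator `∂_φ` on `(k+1)`-vector fields. -/
abbrev diff (k : ℕ) :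
    MultiVector E M (k + 1) →ₗ[ℝ] ((Fin (k + 2) → OneForm E M) → Fun E M) :=
  koszulDiff P.anchor P.bracketφ k

/-- The bivector fields in the kernel of `∂_φ`. -/
abbrev ClosedBivector : Submodule ℝ (MultiVector E M 2) := cocycles P.anchor P.bracketφ 1

/-- The second Lichnerowicz-twisted Poisson cohomology. -/
abbrev HLtP : Type _ := Cohomology P.anchor P.bracketφ 0

/-- The class `[R]^φ` of a bivector field in the kernel of `∂_φ`. -/
def cls (R : P.ClosedBivector) : P.HLtP := Submodule.Quotient.mk R

theorem sharp_bracketφ (α β : OneForm E M) :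
    sharp P.Λ (P.bracketφ α β) = bracket (sharp P.Λ α) (sharp P.Λ β) := by
  ext x
  refine vfield_ext _ _ x fun γ => ?_
  suffices h : γ (sharp P.Λ (P.bracketφ α β)) = γ (bracket (sharp P.Λ α) (sharp P.Λ β)) by rw [h]
  have h1 := P.half_schouten α β γ
  have h2 : schouten P.Λ P.Λ α β γ = (2 : ℝ) • (lieDeriv (sharp P.Λ α) β (sharp P.Λ γ) +
      lieDeriv (sharp P.Λ β) γ (sharp P.Λ α) + lieDeriv (sharp P.Λ γ) α (sharp P.Λ β)) := by
    rw [two_smul]; rfl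
  rw [h2, smul_smul, show (1 / 2 : ℝ) * 2 = 1 by norm_num, one_smul] at h1
  have h3 : sharpForm P.Λ 3 P.φ ![α, β, γ] =
      - P.φ ![sharp P.Λ α, sharp P.Λ β, sharp P.Λ γ] := by
    rw [sharpForm, signedPullback_apply]
    have : (fun i => sharp P.Λ (![α, β, γ] i)) = ![sharp P.Λ α, sharp P.Λ β, sharp P.Λ γ] := by
      funext i; fin_cases i <;> rfl
    rw [this]; ring
  rw [h3] at h1
  have h4 : γ (sharp P.Λ (P.bracketφ α β)) = -(P.bracketφ α β) (sharp P.Λ γ) := by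
    rw [apply_sharp, apply_sharp, alt_two_swap]
  rw [h4]
  set a := sharp P.Λ α with ha
  set b := sharp P.Λ β with hb
  set c := sharp P.Λ γ with hc
  have e1 : (P.bracketφ α β) c = lieDeriv a β c - lieDeriv b α c - act c (P.Λ ![α, β]) +
      P.φ ![a, b, c] := rfl
  rw [e1]
  have e2 : lieDeriv b γ a = act b (γ a) - γ (bracket b a) := rfl
  have e3 : lieDeriv c α b = act c (α b) - α (bracket c b) := rfl
  have e4 : lieDeriv b α c = act b (α c) - α (bracket b c) := rfl
  have e5 : α (bracket c b) = -α (bracket b c) := by rw [bracket_swap, map_neg]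
  have e6 : γ (bracket b a) = -γ (bracket a b) := by rw [bracket_swap, map_neg]
  have e7 : α b = -P.Λ ![α, β] := by rw [hb, apply_sharp, alt_two_swap]
  have e8 : α c = -γ a := by rw [hc, ha, apply_sharp, apply_sharp, alt_two_swap]
  rw [e2, e3, e5, e6, e7, map_neg] at h1
  rw [e4, e8, map_neg]
  linear_combination -h1

/-- The homomorphism `Λ^♯ : H²_dR(M, ℝ) → H²_{L-tP}(M)`, `[η] ↦ [Λ^♯ η]^φ`. -/
def sharpCohomology : HdR E M →ₗ[ℝ] P.HLtP :=
  cohomologyMap (sharp P.Λ) (fun _ => rfl) P.sharp_bracketφ 0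

end TwistedPoissonStructure

end Poisson

/-! ### Complex line bundles, connections and contravariant derivatives -/

section LineBundle

variable (E)
variable (K : M → Type*) [TopologicalSpace (TotalSpace ℂ K)] [∀ x, AddCommGroup (K x)]
  [∀ x, Module ℂ (K x)] [∀ x, TopologicalSpace (K x)] [FiberBundle ℂ K]
  [VectorBundle ℂ ℂ K] [VectorBundle ℝ ℂ K]

/-- The space `Γ(K)` of smooth sections of the complex line bundle `K`. -/
abbrev Sec : Type _ := Cₛ^∞⟮𝓘(ℝ, E); ℂ, K⟯

/-- The pointwise action of complex constants on sections. -/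
instance secModule : Module ℂ (Sec E K) where
  smul c s := ⟨fun x => c • s x, fun x₀ => by
    rw [contMDiffAt_section]
    have hs := (contMDiffAt_section x₀).1 (s.contMDiff x₀)
    refine ContMDiffAt.congr_of_eventuallyEq
      (((ContinuousLinearMap.mul ℝ ℂ c).contMDiff.contMDiffAt).comp x₀ hs) ?_
    filter_upwards [(trivializationAt ℂ K x₀).open_baseSet.mem_nhds
      (FiberBundle.mem_baseSet_trivializationAt ℂ K x₀)] with x hx
    exact ((trivializationAt ℂ K x₀).linear ℂ hx).map_smul c (s x)⟩
  one_smul s := by ext x; exact one_smul ℂ (s x)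
  mul_smul f g s := by ext x; exact mul_smul f g (s x)
  smul_zero f := by ext x; exact smul_zero f
  smul_add f s t := by ext x; exact smul_add f (s x) (t x)
  add_smul f g s := by ext x; exact add_smul f g (s x)
  zero_smul s := by ext x; exact zero_smul ℂ (s x)

variable [ContMDiffVectorBundle ∞ ℂ K 𝓘(ℝ, E)]

/-- A smooth Hermitian metric on `K`, linear in the first argument and antilinear in the second. -/
structure HermitianMetric where
  inner : ∀ x, K x →ₗ[ℂ] K x →ₗ⋆[ℂ] ℂ
  conj_symm : ∀ x (v w : K x), inner x v w = (starRingEnd ℂ) (inner x w v)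
  pos : ∀ x (v : K x), v ≠ 0 → 0 < (inner x v v).re
  smooth : ∀ s t : Sec E K, ContMDiff 𝓘(ℝ, E) 𝓘(ℝ, ℂ) ∞ (fun x => inner x (s x) (t x))

/-- A connection `∇ : Γ(TM) → End_ℂ(Γ(K))` on `K`. -/
structure Connection where
  nabla : VField E M → Module.End ℂ (Sec E K)
  add_left : ∀ X Y, nabla (X + Y) = nabla X + nabla Y
  smul_left : ∀ (f : Fun E M) X s, nabla (f • X) s = f • nabla X s
  leibniz : ∀ X (f : Fun E M) s, nabla X (f • s) = f • nabla X s + act X f • s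

/-- A contravariant derivative `D : Γ(T^*M) → End_ℂ(Γ(K))` on `K`. -/
structure ContravariantDerivative (P : TwistedPoissonStructure E M) where
  D : OneForm E M → Module.End ℂ (Sec E K)
  add_left : ∀ α β, D (α + β) = D α + D β
  smul_left : ∀ (f : Fun E M) α s, D (f • α) s = f • D α s
  leibniz : ∀ α (f : Fun E M) s, D α (f • s) = f • D α s + act (sharp P.Λ α) f • s

variable {E K}

/-- The smooth function `h(s, t)`. -/
def HermitianMetric.pair (h : HermitianMetric E K) (s t : Sec E K) : CFun E M :=
  ⟨fun x => h.inner x (s x) (t x), h.smooth s t⟩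

/-- The form `Ω` takes purely imaginary values. -/
def IsPurelyImaginary {L : Type*} [AddCommGroup L] [Module (Fun E M) L]
    (Ω : L [⋀^Fin 2]→ₗ[Fun E M] CFun E M) : Prop :=
  ∀ a x, (Ω a x).re = 0

/-- `Φ = (i / 2π) Ω`, where `Φ` is real. -/
def EqChernMultiple {L : Type*} [AddCommGroup L] [Module (Fun E M) L]
    (Φ : L [⋀^Fin 2]→ₗ[Fun E M] Fun E M) (Ω : L [⋀^Fin 2]→ₗ[Fun E M] CFun E M) : Prop :=
  ∀ a x, ((Φ a x : ℝ) : ℂ) = Complex.I / (2 * Real.pi) * Ω a x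

namespace Connection

variable (C : Connection E K)

/-- `X(h(s, t)) = h(∇_X s, t) + h(s, ∇_X t)`. -/
def IsHermitian (h : HermitianMetric E K) : Prop :=
  ∀ X s t, act X (h.pair s t) = h.pair (C.nabla X s) t + h.pair s (C.nabla X t)

/-- The curvature `∇_X ∘ ∇_Y - ∇_Y ∘ ∇_X - ∇_{[X, Y]}`. -/
def curvature (X Y : VField E M) : Module.End ℂ (Sec E K) :=
  C.nabla X * C.nabla Y - C.nabla Y * C.nabla X - C.nabla (bracket X Y)

/-- The curvature of the connection is multiplication by `Ω`. -/
def IsCurvatureForm (Ω : CForm E M 2) : Prop :=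
  ∀ X Y s x, C.curvature X Y s x = Ω ![X, Y] x • s x

/-- The contravariant derivative `D_α = ∇_{Λ^♯ α}`. -/
def contravariant (P : TwistedPoissonStructure E M) : ContravariantDerivative E K P where
  D α := C.nabla (sharp P.Λ α)
  add_left α β := by rw [map_add, C.add_left]
  smul_left f α s := by rw [map_smul, C.smul_left]
  leibniz α f s := C.leibniz (sharp P.Λ α) f s

end Connection

namespace ContravariantDerivative

variable {P : TwistedPoissonStructure E M} (C : ContravariantDerivative E K P)

/-- `(Λ^♯ α)(h(s, t)) = h(D_α s, t) + h(s, D_α t)`. -/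
def IsHermitian (h : HermitianMetric E K) : Prop :=
  ∀ α s t, act (sharp P.Λ α) (h.pair s t) = h.pair (C.D α s) t + h.pair s (C.D α t)

/-- The curvature `D_α ∘ D_β - D_β ∘ D_α - D_{{α, β}^φ}`. -/
def curvature (α β : OneForm E M) : Module.End ℂ (Sec E K) :=
  C.D α * C.D β - C.D β * C.D α - C.D (P.bracketφ α β)

/-- The curvature of the contravariant derivative is multiplication by the complex bivector
field `Π`. -/
def IsCurvatureBivector (Pi : CMultiVector E M 2) : Prop :=
  ∀ α β s x, C.curvature α β s x = Pi ![α, β] x • s x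

end ContravariantDerivative

variable (E K)

/-- The class `c` is represented by `(i / 2π) Ω`, where `Ω` is the curvature form of some connection
on `K` which is Hermitian for some Hermitian metric. -/
def IsFirstChernClass (c : HdR E M) : Prop :=
  ∃ (h : HermitianMetric E K) (C : Connection E K) (Ω : CForm E M 2) (Φ : ClosedForm E M),
    C.IsHermitian h ∧ C.IsCurvatureForm Ω ∧ EqChernMultiple (Φ : Form E M 2) Ω ∧
      c = deRhamClass Φ

open Classical in
/-- The first real Chern class `c₁(K, ℝ)`: the unique de Rham class which is represented by
`(i / 2π) Ω` for the curvature forms `Ω` of the Hermitian connections on `K`. -/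
def firstChernClass : HdR E M :=
  if h : ∃! c, IsFirstChernClass E K c then h.choose else 0

end LineBundle

end Calculus

end TwistedPoisson

end

open scoped Manifold ContDiff Topology
open Bundle

set_option linter.unusedSectionVars false

noncomputable section

namespace TwistedPoisson

/-! ### The Lie bracket as the commutator of derivations. -/

section Calculus

variable {E : Type*} [NormedAddCommGroup E] [NormedSpace ℝ E]
  {M : Type*} [TopologicalSpace M] [ChartedSpace E M] [IsManifold 𝓘(ℝ, E) ∞ M]

/-! The twisted Poisson condition says exactly what is needed for `Λ^♯` to carry `{·,·}^φ` to the
Lie bracket (`sharp_bracketφ`). Hence the curvature of `D` at `(α, β)` is the curvature of `∇` at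
`(Λ^♯ α, Λ^♯ β)` (`Connection.contravariant_curvature`). If `Ω` is the curvature form of `∇`, then
`Π` is the pullback of `Ω` by `Λ^♯`, with sign `(-1)² = 1`. Since `Λ^♯` is a chain map up to sign,
`(i/2π) Π` is closed and represents the image of the class of `(i/2π) Ω`.

What remains is Chern–Weil theory in rank one. The curvature is linear over smooth functions because
`[X, Y]` acts as `XY - YX` (`act_bracket`), and such an operator on the sections of a line bundle is
multiplication by a function (`exists_eq_cmul`); this yields `Ω`. Compatibility with the metric
makes `Ω` imaginary, and the Bianchi identity makes it closed. Two connections differ by a one-form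
`A`, and their curvature forms by `dA` (`IsCurvatureForm.sub_eq`), so the class of `(i/2π) Ω` does
not depend on the connection. This is what identifies `firstChernClass`, which is defined through
unique existence. `Π` is unique because every point has a section that does not vanish there. -/

/-- The representative of a vector field in the chart at `x₀`. -/
def chartRep (x₀ : M) (X : VField E M) (y : E) : E :=
  VectorField.mpullbackWithin 𝓘(ℝ, E) 𝓘(ℝ, E) (extChartAt 𝓘(ℝ, E) x₀).symm X
    (Set.range 𝓘(ℝ, E)) y

/-- Chain rule: pulling `X` back applies the inverse of the differential of the inverse chart, and
the two cancel. -/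
theorem fderiv_comp_extChartAt_symm {W : Type*} [NormedAddCommGroup W] [NormedSpace ℝ W]
    (x₀ : M) (X : VField E M) (g : C^∞⟮𝓘(ℝ, E), M; 𝓘(ℝ, W), W⟯) {y : E}
    (hy : y ∈ (extChartAt 𝓘(ℝ, E) x₀).target) :
    fderiv ℝ (g ∘ (extChartAt 𝓘(ℝ, E) x₀).symm) y (chartRep x₀ X y) =
      act X g ((extChartAt 𝓘(ℝ, E) x₀).symm y) := by
  have h1 : MDifferentiableWithinAt 𝓘(ℝ, E) 𝓘(ℝ, E) (extChartAt 𝓘(ℝ, E) x₀).symm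
      (Set.range 𝓘(ℝ, E)) y := by
    have : IsManifold 𝓘(ℝ, E) 1 M := IsManifold.of_le (n := ∞) (by simp)
    exact mdifferentiableWithinAt_extChartAt_symm hy
  have hinv : (mfderivWithin 𝓘(ℝ, E) 𝓘(ℝ, E) (extChartAt 𝓘(ℝ, E) x₀).symm
      (Set.range 𝓘(ℝ, E)) y).IsInvertible := by
    have : IsManifold 𝓘(ℝ, E) 1 M := IsManifold.of_le (n := ∞) (by simp)
    exact isInvertible_mfderivWithin_extChartAt_symm hy
  have hg : MDifferentiableAt 𝓘(ℝ, E) 𝓘(ℝ, W) g ((extChartAt 𝓘(ℝ, E) x₀).symm y) :=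
    g.mdifferentiableAt
  have h2 := mfderiv_comp_mfderivWithin y hg h1 (𝓘(ℝ, E).uniqueMDiffOn _ (by simp))
  rw [act_apply]
  have h3 : fderiv ℝ (g ∘ (extChartAt 𝓘(ℝ, E) x₀).symm) y =
      mfderivWithin 𝓘(ℝ, E) 𝓘(ℝ, W) (g ∘ (extChartAt 𝓘(ℝ, E) x₀).symm)
        (Set.range 𝓘(ℝ, E)) y := by
    rw [mfderivWithin_eq_fderivWithin]; simp
  rw [h3, h2]
  have h4 := hinv.self_apply_inverse (X ((extChartAt 𝓘(ℝ, E) x₀).symm y))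
  exact congrArg (mfderiv 𝓘(ℝ, E) 𝓘(ℝ, W) g ((extChartAt 𝓘(ℝ, E) x₀).symm y)) h4

variable [FiniteDimensional ℝ E]

/-- The manifold bracket at `x₀` is by definition computed in the chart at `x₀`. At the centre of
that chart the differentials of the chart and of its inverse are the identity, so no transition
terms appear. -/
theorem chartRep_bracket (x₀ : M) (X Y : VField E M) :
    chartRep x₀ (bracket X Y) (extChartAt 𝓘(ℝ, E) x₀ x₀) =
      VectorField.lieBracket ℝ (chartRep x₀ X) (chartRep x₀ Y) (extChartAt 𝓘(ℝ, E) x₀ x₀) := by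
  have : IsManifold 𝓘(ℝ, E) 1 M := IsManifold.of_le (n := ∞) (by simp)
  have h1 : chartRep x₀ (bracket X Y) (extChartAt 𝓘(ℝ, E) x₀ x₀) = (bracket X Y x₀ : E) := by
    refine Eq.trans ?_ (congrArg (fun x => (bracket X Y x : E))
      (extChartAt_to_inv (I := 𝓘(ℝ, E)) x₀))
    exact (DFunLike.congr_fun (congrArg ContinuousLinearMap.inverse
      (mfderivWithin_range_extChartAt_symm (I := 𝓘(ℝ, E)) (x := x₀))) _).trans
        (DFunLike.congr_fun (ContinuousLinearMap.inverse_id (R := ℝ) (M := E)) _)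
  let w : E := VectorField.lieBracketWithin ℝ (chartRep x₀ X) (chartRep x₀ Y)
    ((extChartAt 𝓘(ℝ, E) x₀).symm ⁻¹' Set.univ ∩ Set.range 𝓘(ℝ, E)) (extChartAt 𝓘(ℝ, E) x₀ x₀)
  have h2 : (bracket X Y x₀ : E) = w :=
    (DFunLike.congr_fun (congrArg ContinuousLinearMap.inverse
      (mfderiv_extChartAt_self (I := 𝓘(ℝ, E)) (x := x₀))) _).trans
        (DFunLike.congr_fun (ContinuousLinearMap.inverse_id (R := ℝ) (M := E)) w)
  rw [h1, h2, ← VectorField.lieBracketWithin_univ]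
  simp only [w, Set.preimage_univ, Set.univ_inter, ModelWithCorners.range_eq_univ]

theorem differentiableAt_chartRep (x₀ : M) (X : VField E M) :
    DifferentiableAt ℝ (chartRep x₀ X) (extChartAt 𝓘(ℝ, E) x₀ x₀) := by
  have := FiniteDimensional.complete ℝ E
  have h0 : IsManifold 𝓘(ℝ, E) 2 M := IsManifold.of_le (n := ∞) (by norm_cast)
  have h := MDifferentiableWithinAt.differentiableWithinAt_mpullbackWithin_vectorField
    (X.mdifferentiableAt (x := x₀)).mdifferentiableWithinAt (s := Set.univ)
  exact h.differentiableAt (by simp)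

/-- In the chart centred at the given point this is the symmetry of the second derivative of `g`. -/
theorem act_bracket {W : Type*} [NormedAddCommGroup W] [NormedSpace ℝ W]
    (X Y : VField E M) (g : C^∞⟮𝓘(ℝ, E), M; 𝓘(ℝ, W), W⟯) :
    act (bracket X Y) g = act X (act Y g) - act Y (act X g) := by
  ext x₀
  have hy : extChartAt 𝓘(ℝ, E) x₀ x₀ ∈ (extChartAt 𝓘(ℝ, E) x₀).target :=
    mem_extChartAt_target x₀
  have hsymm : (extChartAt 𝓘(ℝ, E) x₀).symm (extChartAt 𝓘(ℝ, E) x₀ x₀) = x₀ :=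
    extChartAt_to_inv x₀
  -- The second derivation differentiates this identity, so it is needed on a neighbourhood and not
  -- only at the centre.
  have hnhds : ∀ Z : VField E M,
      (fun y => fderiv ℝ (g ∘ (extChartAt 𝓘(ℝ, E) x₀).symm) y (chartRep x₀ Z y))
        =ᶠ[𝓝 (extChartAt 𝓘(ℝ, E) x₀ x₀)] (act Z g) ∘ (extChartAt 𝓘(ℝ, E) x₀).symm := by
    intro Z
    filter_upwards [extChartAt_target_mem_nhds (I := 𝓘(ℝ, E)) x₀] with y hy
    exact fderiv_comp_extChartAt_symm x₀ Z g hy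
  have hg : ContDiffAt ℝ 2 (g ∘ (extChartAt 𝓘(ℝ, E) x₀).symm) (extChartAt 𝓘(ℝ, E) x₀ x₀) := by
    have h1 : ContMDiffAt 𝓘(ℝ, E) 𝓘(ℝ, E) ∞ (extChartAt 𝓘(ℝ, E) x₀).symm
        (extChartAt 𝓘(ℝ, E) x₀ x₀) :=
      (contMDiffOn_extChartAt_symm x₀).contMDiffAt (extChartAt_target_mem_nhds x₀)
    exact ((g.contMDiff.contMDiffAt.comp _ h1).contDiffAt).of_le (by norm_cast)
  have key := VectorField.fderiv_apply_lieBracket hg (by simp)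
    (differentiableAt_chartRep x₀ Y) (differentiableAt_chartRep x₀ X)
  rw [← chartRep_bracket, fderiv_comp_extChartAt_symm x₀ _ g hy, (hnhds X).fderiv_eq,
    (hnhds Y).fderiv_eq, fderiv_comp_extChartAt_symm x₀ _ _ hy,
    fderiv_comp_extChartAt_symm x₀ _ _ hy, hsymm] at key
  exact key

theorem bracket_self (X : VField E M) : bracket X X = 0 := by
  ext x
  exact congrFun VectorField.mlieBracket_self x

theorem bracket_add_left (X Y Z : VField E M) :
    bracket (X + Y) Z = bracket X Z + bracket Y Z := by
  rw [bracket_swap, bracket_add_right, neg_add, ← bracket_swap, ← bracket_swap]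

theorem bracket_jacobi (X Y Z : VField E M) :
    bracket X (bracket Y Z) = bracket (bracket X Y) Z + bracket Y (bracket X Z) := by
  have := FiniteDimensional.complete ℝ E
  have : IsManifold 𝓘(ℝ, E) (minSmoothness ℝ 3) M := by
    rw [minSmoothness_of_isRCLikeNormedField]
    exact IsManifold.of_le (n := ∞) (by norm_cast)
  have h : ∀ V : VField E M, ContMDiff 𝓘(ℝ, E) (𝓘(ℝ, E).prod 𝓘(ℝ, E)) (minSmoothness ℝ 2)
      (fun x => (⟨x, V x⟩ : TangentBundle 𝓘(ℝ, E) M)) := fun V =>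
    V.contMDiff.of_le (by
      rw [minSmoothness_of_isRCLikeNormedField]; norm_cast)
  ext x
  exact congrFun (VectorField.leibniz_identity_mlieBracket (h X) (h Y) (h Z)) x

end Calculus

/-! ### Real and imaginary parts of smooth functions. -/

section CFun

variable {E : Type*} [NormedAddCommGroup E] [NormedSpace ℝ E]
  {M : Type*} [TopologicalSpace M] [ChartedSpace E M]

/-- The composition of a smooth function with a continuous linear map. -/
def postcomp {V W : Type*} [NormedAddCommGroup V] [NormedSpace ℝ V] [NormedAddCommGroup W]
    [NormedSpace ℝ W] (T : V →L[ℝ] W) :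
    C^∞⟮𝓘(ℝ, E), M; 𝓘(ℝ, V), V⟯ →ₗ[Fun E M] C^∞⟮𝓘(ℝ, E), M; 𝓘(ℝ, W), W⟯ where
  toFun g := ⟨fun x => T (g x), T.contMDiff.comp g.contMDiff⟩
  map_add' f g := by ext x; exact map_add T (f x) (g x)
  map_smul' f g := by ext x; exact map_smul T (f x) (g x)

theorem act_postcomp [IsManifold 𝓘(ℝ, E) ∞ M] {V W : Type*} [NormedAddCommGroup V]
    [NormedSpace ℝ V] [NormedAddCommGroup W] [NormedSpace ℝ W] (T : V →L[ℝ] W) (X : VField E M)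
    (g : C^∞⟮𝓘(ℝ, E), M; 𝓘(ℝ, V), V⟯) : act X (postcomp T g) = postcomp T (act X g) := by
  ext x
  have h := mfderiv_comp x T.mdifferentiableAt (g.mdifferentiableAt (x := x))
  rw [T.mfderiv_eq] at h
  exact DFunLike.congr_fun h (X x)

/-- The real part of a complex valued smooth function. -/
abbrev reFun : CFun E M →ₗ[Fun E M] Fun E M := postcomp Complex.reCLM

/-- The imaginary part of a complex valued smooth function. -/
abbrev imFun : CFun E M →ₗ[Fun E M] Fun E M := postcomp Complex.imCLM

end CFun

/-! ### Operators on sections of a line bundle. -/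

section LineBundle

variable {E : Type*} [NormedAddCommGroup E] [NormedSpace ℝ E]
  {M : Type*} [TopologicalSpace M] [ChartedSpace E M]
  {K : M → Type*} [TopologicalSpace (TotalSpace ℂ K)] [∀ x, AddCommGroup (K x)]
  [∀ x, Module ℂ (K x)] [∀ x, TopologicalSpace (K x)] [FiberBundle ℂ K]
  [VectorBundle ℂ ℂ K] [VectorBundle ℝ ℂ K]

/-- The product of a complex valued smooth function and a section. -/
def cmul (c : CFun E M) (s : Sec E K) : Sec E K :=
  reFun c • s + Complex.I • (imFun c • s)

theorem cmul_apply (c : CFun E M) (s : Sec E K) (x : M) : cmul c s x = c x • s x := by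
  change (c x).re • s x + Complex.I • ((c x).im • s x) = c x • s x
  rw [← Complex.coe_smul, ← Complex.coe_smul, smul_smul, ← add_smul, mul_comm,
    Complex.re_add_im]

theorem cmul_add_left (c d : CFun E M) (s : Sec E K) :
    cmul (c + d) s = cmul c s + cmul d s := by
  ext x
  refine (cmul_apply _ _ _).trans ((add_smul (c x) (d x) (s x)).trans ?_)
  rw [← cmul_apply, ← cmul_apply]; rfl

theorem cmul_neg_left (c : CFun E M) (s : Sec E K) : cmul (-c) s = -cmul c s := by
  ext x
  refine (cmul_apply _ _ _).trans ((neg_smul (c x) (s x)).trans ?_)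
  rw [← cmul_apply]; rfl

theorem cmul_sub_left (c d : CFun E M) (s : Sec E K) :
    cmul (c - d) s = cmul c s - cmul d s := by
  rw [sub_eq_add_neg, cmul_add_left, cmul_neg_left, sub_eq_add_neg]

theorem cmul_smul_left (f : Fun E M) (c : CFun E M) (s : Sec E K) :
    cmul (f • c) s = f • cmul c s := by
  ext x
  refine (cmul_apply _ _ _).trans ((smul_assoc (f x) (c x) (s x)).trans ?_)
  rw [← cmul_apply]; rfl

theorem cmul_zero_left (s : Sec E K) : cmul (0 : CFun E M) s = 0 := by
  ext x
  exact (cmul_apply _ _ _).trans (zero_smul ℂ (s x))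

variable [IsManifold 𝓘(ℝ, E) ∞ M] [T2Space M] [FiniteDimensional ℝ E]
  [ContMDiffVectorBundle ∞ ℂ K 𝓘(ℝ, E)]

variable (K) in
/-- Near any point, a section is a multiple of a nowhere vanishing section. -/
theorem exists_local_frame (x₀ : M) :
    ∃ (χ : Fun E M) (σ : Sec E K) (c : Sec E K → CFun E M), (∀ᶠ x in 𝓝 x₀, χ x = 1) ∧
      (∀ᶠ x in 𝓝 x₀, σ x ≠ 0) ∧ ∀ s, χ • s = cmul (c s) σ := by
  let e := trivializationAt ℂ K x₀
  have hx₀ : x₀ ∈ e.baseSet := FiberBundle.mem_baseSet_trivializationAt _ _ x₀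
  obtain ⟨ψ, -, hψ⟩ := (SmoothBumpFunction.nhds_basis_tsupport (I := 𝓘(ℝ, E)) x₀).mem_iff.1
    (e.open_baseSet.mem_nhds hx₀)
  have hψs : ContMDiff 𝓘(ℝ, E) 𝓘(ℝ, ℝ) ∞ ψ := ψ.contMDiff
  have hoff : ∀ x, x ∉ e.baseSet → ψ x = 0 := fun x hx =>
    image_eq_zero_of_notMem_tsupport fun h => hx (hψ h)
  have hσ : ContMDiffOn 𝓘(ℝ, E) (𝓘(ℝ, E).prod 𝓘(ℝ, ℂ)) ∞
      (fun x => TotalSpace.mk' ℂ x (e.symm x 1)) e.baseSet := by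
    rw [Trivialization.contMDiffOn_section_baseSet_iff]
    refine (contMDiffOn_const (c := (1 : ℂ))).congr fun x hx => ?_
    rw [e.apply_mk_symm hx]
  have hcs : ∀ s : Sec E K, ContMDiff 𝓘(ℝ, E) 𝓘(ℝ, ℂ) ∞
      (fun x => ψ x • (e ⟨x, s x⟩).2) := by
    intro s
    refine contMDiff_of_tsupport fun x hx => ?_
    have hx' : x ∈ e.baseSet := hψ (tsupport_smul_subset_left _ _ hx)
    exact (hψs x).smul ((Trivialization.contMDiffAt_section_iff e hx').1 (s.contMDiff x))
  let ψ' : Fun E M := ⟨ψ, hψs⟩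
  -- The cutoff is squared: one factor `ψ` extends the local frame to a global section, the other
  -- extends the coefficient to a global function.
  refine ⟨ψ' * ψ', ⟨_, ContMDiffOn.smul_section_of_tsupport (hψs.contMDiffOn) e.open_baseSet hψ hσ⟩,
    fun s => ⟨_, hcs s⟩, ?_, ?_, fun s => ?_⟩
  · filter_upwards [ψ.eventuallyEq_one] with x hx
    change ψ x * ψ x = 1
    rw [hx]; simp
  · filter_upwards [ψ.eventuallyEq_one, e.open_baseSet.mem_nhds hx₀] with x hx hxe h0
    change ψ x • e.symm x 1 = 0 at h0
    rw [hx, Pi.one_apply, one_smul] at h0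
    have h1 := (e.linearEquivAt ℂ x hxe).symm.map_eq_zero_iff.1 h0
    exact one_ne_zero h1
  · ext x
    refine Eq.trans ?_ (cmul_apply _ _ _).symm
    change (ψ x * ψ x) • s x = (ψ x • (e ⟨x, s x⟩).2) • (ψ x • e.symm x 1)
    by_cases hx : x ∈ e.baseSet
    · have h1 : s x = (e ⟨x, s x⟩).2 • e.symm x 1 := by
        have h2 := (e.linearEquivAt ℂ x hx).symm.map_smul (e ⟨x, s x⟩).2 1
        rw [smul_eq_mul, mul_one] at h2
        exact ((e.linearEquivAt ℂ x hx).symm_apply_apply (s x)).symm.trans h2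
      nth_rewrite 1 [h1]
      rw [mul_smul, smul_assoc, smul_comm (ψ x) (e ⟨x, s x⟩).2]
    · simp [hoff x hx]

variable (E K) in
theorem exists_section_ne_zero (x : M) : ∃ s : Sec E K, s x ≠ 0 := by
  obtain ⟨-, σ, -, -, hσ, -⟩ := exists_local_frame (E := E) K x
  exact ⟨σ, hσ.self_of_nhds⟩

-- The fibres are one-dimensional and some section is nonzero at each point, so functions can be
-- compared through their action on sections.
variable (K) in
theorem cfun_ext {c c' : CFun E M} (h : ∀ s : Sec E K, cmul c s = cmul c' s) : c = c' := by
  ext x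
  obtain ⟨s, hs⟩ := exists_section_ne_zero E K x
  have h1 := congrArg (fun t : Sec E K => t x) (h s)
  simp only [cmul_apply] at h1
  exact smul_left_injective ℂ hs h1

/-- Linearity over real functions and over complex constants together give linearity over complex
functions; this is why `cmul` is built from real and imaginary parts. -/
theorem map_cmul {F : Module.End ℂ (Sec E K)} (hF : ∀ (f : Fun E M) s, F (f • s) = f • F s)
    (c : CFun E M) (s : Sec E K) : F (cmul c s) = cmul c (F s) := by
  rw [cmul, map_add, F.map_smul, hF, hF]; rfl

/-- An endomorphism of the space of sections of a line bundle which is linear over smooth functions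
is the multiplication by a smooth function. -/
theorem exists_eq_cmul {F : Module.End ℂ (Sec E K)}
    (hF : ∀ (f : Fun E M) s, F (f • s) = f • F s) :
    ∃ c : CFun E M, ∀ s, F s = cmul c s := by
  have hloc : ∀ x₀, ∃ d : CFun E M, ∀ᶠ x in 𝓝 x₀, ∀ s, F s x = d x • s x := by
    intro x₀
    obtain ⟨χ, σ, c, hχ, -, hc⟩ := exists_local_frame (E := E) K x₀
    refine ⟨c (F σ), ?_⟩
    filter_upwards [hχ] with x hx s
    have h0 : ∀ t, t x = c t x • σ x := by
      intro t
      have h := congrArg (fun t : Sec E K => t x) (hc t)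
      simp only [cmul_apply, section_smul_apply] at h
      rwa [hx, one_smul] at h
    -- Where `χ = 1`, `F s = c(s) F σ = c(s) c(F σ) σ = c(F σ) s`, so the local multiplier is `c (F
    -- σ)`.
    have h1 := congrArg (fun t : Sec E K => F t x) (hc s)
    simp only [map_cmul hF, hF, cmul_apply, section_smul_apply] at h1
    rw [hx, one_smul, h0 (F σ), smul_comm, ← h0 s] at h1
    exact h1
  choose d hd using hloc
  refine ⟨⟨fun x => d x x, fun x₀ => ?_⟩, fun s => ?_⟩
  -- Near `x₀` the multipliers `d x` and `d x₀` agree at `x`, since both give the value of `F` on a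
  -- section that is nonzero there.
  · refine ((d x₀).contMDiff x₀).congr_of_eventuallyEq ?_
    filter_upwards [hd x₀] with x hx
    obtain ⟨s, hs⟩ := exists_section_ne_zero E K x
    exact smul_left_injective ℂ hs (((hd x).self_of_nhds s).symm.trans (hx s))
  · ext x
    refine Eq.trans ?_ (cmul_apply _ _ _).symm
    exact (hd x).self_of_nhds s

end LineBundle

/-! ### Alternating maps and the Koszul differential in low degree. -/

section Alternating

variable {A L B : Type*} [CommRing A] [AddCommGroup L] [Module A L] [AddCommGroup B] [Module A B]

theorem eq_vec_two {L : Type*} (a : Fin 2 → L) : a = ![a 0, a 1] := by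
  funext i; fin_cases i <;> rfl

/-- The alternating map determined by an alternating bilinear function. -/
def alternatingOfBilinear (b : L → L → B) (hadd : ∀ x y z, b (x + y) z = b x z + b y z)
    (hsmul : ∀ (f : A) x y, b (f • x) y = f • b x y) (hself : ∀ x, b x x = 0)
    (hswap : ∀ x y, b x y = -b y x) : L [⋀^Fin 2]→ₗ[A] B where
  toFun a := b (a 0) (a 1)
  map_update_add' a i x y := by
    fin_cases i
    · simpa using hadd x y (a 1)
    · simp only [Fin.mk_one, Function.update_self, ne_eq, zero_ne_one, not_false_eq_true,
        Function.update_of_ne]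
      rw [hswap, hadd, neg_add, ← hswap, ← hswap]
  map_update_smul' a i f x := by
    fin_cases i
    · simpa using hsmul f x (a 1)
    · simp only [Fin.mk_one, Function.update_self, ne_eq, zero_ne_one, not_false_eq_true,
        Function.update_of_ne]
      rw [hswap, hsmul, ← smul_neg, ← hswap]
  map_eq_zero_of_eq' a i j h hij := by
    have h01 : a 0 = a 1 := by
      fin_cases i <;> fin_cases j <;> first | exact absurd rfl hij | exact h | exact h.symm
    rw [h01]
    exact hself _

variable [Algebra ℝ A] (ρ : L → A →ₗ[ℝ] A) (br : L → L → L)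

theorem koszulDiff_zero_apply (P : L [⋀^Fin 1]→ₗ[A] A) (a : Fin 2 → L) :
    koszulDiff ρ br 0 P a =
      ρ (a 0) (P ![a 1]) - ρ (a 1) (P ![a 0]) - P ![br (a 0) (a 1)] := by
  have h0 : (0 : Fin 2).removeNth a = ![a 1] := by funext i; fin_cases i; rfl
  have h1 : (1 : Fin 2).removeNth a = ![a 0] := by funext i; fin_cases i; rfl
  have h2 : ∀ (u : L) (v : Fin 0 → L), (Matrix.vecCons u v : Fin 1 → L) = ![u] := by
    intro u v; funext i; fin_cases i; rfl
  have hI : Finset.Ici (0 : Fin 1) = {0} := by decide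
  change (∑ i : Fin 2, (-1) ^ (i : ℕ) * ρ (a i) (P (i.removeNth a))) -
      ∑ i : Fin 1, ∑ j ∈ Finset.Ici i, (-1) ^ (i + j : ℕ) *
        P (Matrix.vecCons (br (a i.castSucc) (a j.succ))
          (j.removeNth (i.castSucc.removeNth a))) = _
  rw [Fin.sum_univ_two, Fin.sum_univ_one, hI, Finset.sum_singleton, h0, h1]
  refine (congrArg₂ (· - ·) rfl (congrArg ((-1) ^ 0 * P ·) (h2 _ _))).trans ?_
  change (-1) ^ 0 * ρ (a 0) (P ![a 1]) + (-1) ^ 1 * ρ (a 1) (P ![a 0]) -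
    (-1) ^ 0 * P ![br (a 0) (a 1)] = _
  ring

theorem koszulDiff_one_apply (P : L [⋀^Fin 2]→ₗ[A] A) (a : Fin 3 → L) :
    koszulDiff ρ br 1 P a =
      ρ (a 0) (P ![a 1, a 2]) - ρ (a 1) (P ![a 0, a 2]) + ρ (a 2) (P ![a 0, a 1]) -
        P ![br (a 0) (a 1), a 2] + P ![br (a 0) (a 2), a 1] - P ![br (a 1) (a 2), a 0] := by
  have h0 : (0 : Fin 3).removeNth a = ![a 1, a 2] := by funext i; fin_cases i <;> rfl
  have h1 : (1 : Fin 3).removeNth a = ![a 0, a 2] := by funext i; fin_cases i <;> rfl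
  have h2 : (2 : Fin 3).removeNth a = ![a 0, a 1] := by funext i; fin_cases i <;> rfl
  have h3 : ∀ (u v w : L), Matrix.vecCons u ((0 : Fin 2).removeNth ![v, w]) = ![u, w] := by
    intro u v w; funext i; fin_cases i <;> rfl
  have h4 : ∀ (u v w : L), Matrix.vecCons u ((1 : Fin 2).removeNth ![v, w]) = ![u, v] := by
    intro u v w; funext i; fin_cases i <;> rfl
  -- The index `j` stands for argument `j + 1`: the pairs `(0,0)`, `(0,1)`, `(1,1)` bracket the
  -- arguments `(0,1)`, `(0,2)`, `(1,2)`.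
  have hI0 : Finset.Ici (0 : Fin 2) = {0, 1} := by decide
  have hI1 : Finset.Ici (1 : Fin 2) = {1} := by decide
  have hc0 : (0 : Fin 2).castSucc = 0 := rfl
  have hc1 : (1 : Fin 2).castSucc = 1 := rfl
  change (∑ i : Fin 3, (-1) ^ (i : ℕ) * ρ (a i) (P (i.removeNth a))) -
      ∑ i : Fin 2, ∑ j ∈ Finset.Ici i, (-1) ^ (i + j : ℕ) *
        P (Matrix.vecCons (br (a i.castSucc) (a j.succ))
          (j.removeNth (i.castSucc.removeNth a))) = _
  rw [Fin.sum_univ_three, Fin.sum_univ_two, hI0, hI1, Finset.sum_singleton,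
    Finset.sum_pair (by decide), h0, h1, h2, hc0, hc1, h0, h1, h3, h4, h4]
  change (-1) ^ 0 * ρ (a 0) (P ![a 1, a 2]) + (-1) ^ 1 * ρ (a 1) (P ![a 0, a 2]) +
    (-1) ^ 2 * ρ (a 2) (P ![a 0, a 1]) -
    ((-1) ^ 0 * P ![br (a 0) (a 1), a 2] + (-1) ^ 1 * P ![br (a 0) (a 2), a 1] +
      (-1) ^ 2 * P ![br (a 1) (a 2), a 0]) = _
  ring

end Alternating

/-! ### The curvature form of a connection. -/

section Curvature

variable {E : Type*} [NormedAddCommGroup E] [NormedSpace ℝ E] [FiniteDimensional ℝ E]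
  {M : Type*} [TopologicalSpace M] [T2Space M] [ChartedSpace E M] [IsManifold 𝓘(ℝ, E) ∞ M]
  {K : M → Type*} [TopologicalSpace (TotalSpace ℂ K)] [∀ x, AddCommGroup (K x)]
  [∀ x, Module ℂ (K x)] [∀ x, TopologicalSpace (K x)] [FiberBundle ℂ K]
  [VectorBundle ℂ ℂ K] [VectorBundle ℝ ℂ K] [ContMDiffVectorBundle ∞ ℂ K 𝓘(ℝ, E)]

namespace Connection

variable (C C' : Connection E K)

theorem nabla_zero : C.nabla 0 = 0 := by
  simpa using C.add_left 0 0

theorem nabla_neg (X : VField E M) : C.nabla (-X) = -C.nabla X := by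
  rw [eq_neg_iff_add_eq_zero, ← C.add_left, neg_add_cancel, nabla_zero]

theorem nabla_cmul (X : VField E M) (f : CFun E M) (s : Sec E K) :
    C.nabla X (cmul f s) = cmul f (C.nabla X s) + cmul (act X f) s := by
  simp only [cmul, map_add, LinearMap.map_smul (C.nabla X) Complex.I, C.leibniz, act_postcomp,
    smul_add]
  abel

theorem curvature_apply (X Y : VField E M) (s : Sec E K) :
    C.curvature X Y s =
      C.nabla X (C.nabla Y s) - C.nabla Y (C.nabla X s) - C.nabla (bracket X Y) s := rfl

/-- The first-order terms cancel in pairs, and the coefficient `X(Yf) - Y(Xf) - [X,Y]f` of `s`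
vanishes by `act_bracket`. -/
theorem curvature_smul_right (X Y : VField E M) (f : Fun E M) (s : Sec E K) :
    C.curvature X Y (f • s) = f • C.curvature X Y s := by
  simp only [curvature_apply, C.leibniz, map_add, act_bracket, sub_smul, smul_sub]
  abel

theorem curvature_swap (X Y : VField E M) : C.curvature X Y = -C.curvature Y X := by
  simp only [curvature]
  rw [bracket_swap X Y, nabla_neg]
  abel

theorem curvature_self (X : VField E M) : C.curvature X X = 0 := by
  rw [curvature, bracket_self, nabla_zero, sub_self, sub_zero]

theorem curvature_add_left (X Y Z : VField E M) :
    C.curvature (X + Y) Z = C.curvature X Z + C.curvature Y Z := by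
  simp only [curvature, bracket_add_left, C.add_left, add_mul, mul_add]
  abel

/-- The term `-Y(f) X` in `[fX, Y]` cancels the Leibniz term of `∇_Y (f ∇_X s)`. -/
theorem curvature_smul_left (f : Fun E M) (X Y : VField E M) (s : Sec E K) :
    C.curvature (f • X) Y s = f • C.curvature X Y s := by
  have h : bracket (f • X) Y = -(act Y f • X) + f • bracket X Y := by
    rw [bracket_swap, bracket_smul_right, neg_add, bracket_swap X Y, smul_neg]
  simp only [curvature_apply, h, C.add_left, nabla_neg, C.leibniz, LinearMap.add_apply,
    LinearMap.neg_apply, C.smul_left, smul_sub]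
  abel

theorem exists_curvature_eq_cmul (X Y : VField E M) :
    ∃ c : CFun E M, ∀ s, C.curvature X Y s = cmul c s :=
  exists_eq_cmul (C.curvature_smul_right X Y)

/-- The curvature form of a connection. -/
def curvatureForm : CForm E M 2 :=
  alternatingOfBilinear (fun X Y => (C.exists_curvature_eq_cmul X Y).choose)
    (fun X Y Z => cfun_ext K fun s => by
      rw [cmul_add_left, ← (C.exists_curvature_eq_cmul _ _).choose_spec,
        ← (C.exists_curvature_eq_cmul _ _).choose_spec,
        ← (C.exists_curvature_eq_cmul _ _).choose_spec, curvature_add_left]; rfl)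
    (fun f X Y => cfun_ext K fun s => by
      rw [cmul_smul_left, ← (C.exists_curvature_eq_cmul _ _).choose_spec,
        ← (C.exists_curvature_eq_cmul _ _).choose_spec, curvature_smul_left])
    (fun X => cfun_ext K fun s => by
      rw [cmul_zero_left, ← (C.exists_curvature_eq_cmul _ _).choose_spec, curvature_self]; rfl)
    (fun X Y => cfun_ext K fun s => by
      rw [cmul_neg_left, ← (C.exists_curvature_eq_cmul _ _).choose_spec,
        ← (C.exists_curvature_eq_cmul _ _).choose_spec, curvature_swap]; rfl)

theorem isCurvatureForm_curvatureForm : C.IsCurvatureForm C.curvatureForm := by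
  intro X Y s x
  rw [← cmul_apply]
  exact congrArg (fun t : Sec E K => t x) ((C.exists_curvature_eq_cmul X Y).choose_spec s)

variable {C C'}

theorem IsCurvatureForm.curvature_eq {Ω : CForm E M 2} (hΩ : C.IsCurvatureForm Ω)
    (X Y : VField E M) (s : Sec E K) : C.curvature X Y s = cmul (Ω ![X, Y]) s := by
  ext x
  rw [hΩ, cmul_apply]

/-- Applying `[X, Y] = XY - YX` to `h(s, s)` shows that the curvature is skew-Hermitian. Hence `(Ω +
conj Ω) h(s, s) = 0`, and `h(s, s) ≠ 0` where `s ≠ 0`. -/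
theorem IsCurvatureForm.isPurelyImaginary {Ω : CForm E M 2} (hΩ : C.IsCurvatureForm Ω)
    {h : HermitianMetric E K} (hC : C.IsHermitian h) : IsPurelyImaginary Ω := by
  intro a x
  rw [eq_vec_two a]
  obtain ⟨s, hs⟩ := exists_section_ne_zero E K x
  have hadd : ∀ s s' t : Sec E K, h.pair (s - s') t = h.pair s t - h.pair s' t := by
    intro s s' t; ext x
    exact DFunLike.congr_fun (map_sub (h.inner x) (s x) (s' x)) (t x)
  have hadd' : ∀ s t t' : Sec E K, h.pair s (t - t') = h.pair s t - h.pair s t' := by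
    intro s t t'; ext x
    exact map_sub (h.inner x (s x)) (t x) (t' x)
  have key : h.pair (C.curvature (a 0) (a 1) s) s + h.pair s (C.curvature (a 0) (a 1) s) = 0 := by
    have h1 := act_bracket (a 0) (a 1) (h.pair s s)
    simp only [hC _ _ _, map_add] at h1
    simp only [curvature_apply, hadd, hadd']
    rw [← sub_eq_zero] at h1
    rw [← neg_eq_zero, ← h1]
    abel
  have key' := congrArg (fun f : CFun E M => f x) key
  change h.inner x (C.curvature (a 0) (a 1) s x) (s x) +
    h.inner x (s x) (C.curvature (a 0) (a 1) s x) = 0 at key'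
  rw [hΩ, map_smul, LinearMap.smul_apply, map_smulₛₗ, smul_eq_mul, smul_eq_mul, ← add_mul,
    Complex.add_conj] at key'
  have hpos := h.pos x (s x) hs
  have hne : h.inner x (s x) (s x) ≠ 0 := by
    intro h0; rw [h0] at hpos; simp at hpos
  have := (mul_eq_zero.1 key').resolve_right hne
  have h2 : 2 * (Ω ![a 0, a 1] x).re = 0 := by exact_mod_cast this
  linarith

/-- Multiplication by `X(Ω(Y, Z))` is the commutator of `∇_X` with the curvature at `(Y, Z)`, so the
claim becomes an identity between operators. -/
theorem IsCurvatureForm.bianchi {Ω : CForm E M 2} (hΩ : C.IsCurvatureForm Ω)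
    (X Y Z : VField E M) :
    act X (Ω ![Y, Z]) - act Y (Ω ![X, Z]) + act Z (Ω ![X, Y]) - Ω ![bracket X Y, Z] +
      Ω ![bracket X Z, Y] - Ω ![bracket Y Z, X] = 0 := by
  refine cfun_ext K fun s => ?_
  have hcomm : ∀ U V W : VField E M, cmul (act U (Ω ![V, W])) s =
      (C.nabla U * C.curvature V W - C.curvature V W * C.nabla U) s := by
    intro U V W
    rw [LinearMap.sub_apply, Module.End.mul_apply, Module.End.mul_apply, hΩ.curvature_eq,
      hΩ.curvature_eq, nabla_cmul]
    abel
  have hjac : C.nabla (bracket (bracket X Y) Z) =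
      C.nabla (bracket (bracket X Z) Y) - C.nabla (bracket (bracket Y Z) X) := by
    rw [sub_eq_add_neg, ← nabla_neg, ← C.add_left, bracket_swap (bracket X Z) Y,
      ← bracket_swap X, bracket_jacobi X Y Z]
    congr 1
    abel
  -- The triple products cancel by the Jacobi identity for commutators, the terms with one bracket
  -- cancel in pairs, and `hjac` removes the iterated brackets.
  have hE : (C.nabla X * C.curvature Y Z - C.curvature Y Z * C.nabla X) -
      (C.nabla Y * C.curvature X Z - C.curvature X Z * C.nabla Y) +
      (C.nabla Z * C.curvature X Y - C.curvature X Y * C.nabla Z) - C.curvature (bracket X Y) Z +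
      C.curvature (bracket X Z) Y - C.curvature (bracket Y Z) X = 0 := by
    simp only [curvature, hjac]
    noncomm_ring
  have hs := DFunLike.congr_fun hE s
  simp only [cmul_add_left, cmul_sub_left, hcomm, cmul_zero_left, ← hΩ.curvature_eq]
  exact hs

/-- The Leibniz terms of two connections agree, so their difference is linear over functions. -/
theorem exists_difference_form : ∃ A : VField E M →ₗ[Fun E M] CFun E M,
    ∀ X s, C'.nabla X s = C.nabla X s + cmul (A X) s := by
  have h : ∀ X, ∃ c : CFun E M, ∀ s, (C'.nabla X - C.nabla X) s = cmul c s := fun X =>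
    exists_eq_cmul fun f s => by
      simp only [LinearMap.sub_apply, leibniz, smul_sub]
      abel
  choose A hA using h
  refine ⟨⟨⟨A, fun X Y => cfun_ext K fun s => ?_⟩, fun f X => cfun_ext K fun s => ?_⟩,
    fun X s => ?_⟩
  · rw [cmul_add_left, ← hA, ← hA, ← hA, C.add_left, C'.add_left]
    simp only [LinearMap.sub_apply, LinearMap.add_apply]
    abel
  · change cmul (A (f • X)) s = cmul (f • A X) s
    rw [cmul_smul_left, ← hA, ← hA]
    simp only [LinearMap.sub_apply, smul_left, smul_sub]
  · change _ = _ + cmul (A X) s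
    rw [← hA]
    simp only [LinearMap.sub_apply]
    abel

/-- In rank one the quadratic term `A(X)A(Y) - A(Y)A(X)` vanishes, leaving only `dA`. -/
theorem IsCurvatureForm.sub_eq {Ω Ω' : CForm E M 2} (hΩ : C.IsCurvatureForm Ω)
    (hΩ' : C'.IsCurvatureForm Ω') {A : VField E M →ₗ[Fun E M] CFun E M}
    (hA : ∀ X s, C'.nabla X s = C.nabla X s + cmul (A X) s) (X Y : VField E M) :
    Ω' ![X, Y] - Ω ![X, Y] = act X (A Y) - act Y (A X) - A (bracket X Y) := by
  refine cfun_ext K fun s => ?_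
  have hcc : ∀ c d : CFun E M, cmul c (cmul d s) = cmul d (cmul c s) := by
    intro c d; ext x
    simp only [cmul_apply]
    exact smul_comm _ _ _
  simp only [cmul_sub_left, ← hΩ.curvature_eq, ← hΩ'.curvature_eq]
  simp only [curvature_apply, hA, map_add, nabla_cmul]
  have h1 : ∀ (c : CFun E M) (s t : Sec E K), cmul c (s + t) = cmul c s + cmul c t := by
    intro c s t
    simp only [cmul, smul_add]
    abel
  simp only [h1, hcc (A X) (A Y)]
  abel

end Connection

end Curvature

/-! ### The Chern class and its image under `Λ^♯`. -/

section ChernClass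

/-- The real linear map `z ↦ Re (i z / 2π)`. -/
def chernCLM : ℂ →L[ℝ] ℝ :=
  Complex.reCLM ∘L ContinuousLinearMap.mul ℝ ℂ (Complex.I / (2 * Real.pi))

theorem ofReal_chernCLM {z : ℂ} (hz : z.re = 0) :
    ((chernCLM z : ℝ) : ℂ) = Complex.I / (2 * Real.pi) * z := by
  have hz' : z = (z.im : ℂ) * Complex.I := by
    rw [← Complex.re_add_im z]; simp [hz]
  have h : Complex.I / (2 * Real.pi) * z = ((-(z.im / (2 * Real.pi)) : ℝ) : ℂ) := by
    nth_rewrite 1 [hz']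
    push_cast
    linear_combination (z.im / (2 * Real.pi) : ℂ) * Complex.I_mul_I
  change (((Complex.I / (2 * Real.pi) * z).re : ℝ) : ℂ) = _
  rw [h, Complex.ofReal_re]

variable {E : Type*} [NormedAddCommGroup E] [NormedSpace ℝ E] [FiniteDimensional ℝ E]
  {M : Type*} [TopologicalSpace M] [T2Space M] [ChartedSpace E M] [IsManifold 𝓘(ℝ, E) ∞ M]

/-- Rewrites the relation as composition with a fixed real-linear map, which commutes with
derivations; identities for `Ω` thus pass to `Φ`. -/
theorem EqChernMultiple.apply_eq {L : Type*} [AddCommGroup L] [Module (Fun E M) L]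
    {Φ : L [⋀^Fin 2]→ₗ[Fun E M] Fun E M} {Ω : L [⋀^Fin 2]→ₗ[Fun E M] CFun E M}
    (h : EqChernMultiple Φ Ω) (a : Fin 2 → L) : Φ a = postcomp chernCLM (Ω a) := by
  ext x
  change Φ a x = (Complex.I / (2 * Real.pi) * Ω a x).re
  rw [← h a x, Complex.ofReal_re]

theorem eqChernMultiple_compAlternatingMap {L : Type*} [AddCommGroup L] [Module (Fun E M) L]
    {Ω : L [⋀^Fin 2]→ₗ[Fun E M] CFun E M} (h : IsPurelyImaginary Ω) :
    EqChernMultiple ((postcomp chernCLM).compAlternatingMap Ω) Ω :=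
  fun a x => ofReal_chernCLM (h a x)

variable {K : M → Type*} [TopologicalSpace (TotalSpace ℂ K)] [∀ x, AddCommGroup (K x)]
  [∀ x, Module ℂ (K x)] [∀ x, TopologicalSpace (K x)] [FiberBundle ℂ K]
  [VectorBundle ℂ ℂ K] [VectorBundle ℝ ℂ K] [ContMDiffVectorBundle ∞ ℂ K 𝓘(ℝ, E)]
  {C C' : Connection E K}

theorem Connection.IsCurvatureForm.deRhamDiff_eq_zero {Ω : CForm E M 2}
    (hΩ : C.IsCurvatureForm Ω) {Φ : Form E M 2} (hΦ : EqChernMultiple Φ Ω) :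
    deRhamDiff E M 1 Φ = 0 := by
  funext a
  have h := congrArg (postcomp chernCLM) (hΩ.bianchi (a 0) (a 1) (a 2))
  rw [koszulDiff_one_apply]
  simp only [hΦ.apply_eq, act_postcomp, ← map_sub, ← map_add]
  exact h.trans (map_zero _)

/-- The primitive is the real part of `(i/2π) A`. The two connections may preserve different
metrics, so `A` need not be imaginary; taking the real part still gives a real primitive. -/
theorem Connection.IsCurvatureForm.deRhamClass_eq {Ω Ω' : CForm E M 2}
    (hΩ : C.IsCurvatureForm Ω) (hΩ' : C'.IsCurvatureForm Ω') {Φ Φ' : ClosedForm E M}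
    (hΦ : EqChernMultiple (Φ : Form E M 2) Ω) (hΦ' : EqChernMultiple (Φ' : Form E M 2) Ω') :
    deRhamClass Φ' = deRhamClass Φ := by
  obtain ⟨A, hA⟩ := Connection.exists_difference_form (C := C) (C' := C')
  refine (Submodule.Quotient.eq _).2 ?_
  refine ⟨AlternatingMap.ofSubsingleton (Fun E M) (VField E M) (Fun E M) (0 : Fin 1)
    (postcomp chernCLM ∘ₗ A), funext fun a => ?_⟩
  rw [koszulDiff_zero_apply]
  have h := congrArg (postcomp chernCLM) (hΩ.sub_eq hΩ' hA (a 0) (a 1))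
  change act (a 0) (postcomp chernCLM (A (a 1))) - act (a 1) (postcomp chernCLM (A (a 0))) -
    postcomp chernCLM (A (bracket (a 0) (a 1))) = (Φ' : Form E M 2) a - (Φ : Form E M 2) a
  rw [hΦ.apply_eq, hΦ'.apply_eq, eq_vec_two a, act_postcomp, act_postcomp, ← map_sub,
    ← map_sub, ← map_sub]
  exact h.symm

/-- The given connection supplies existence and `deRhamClass_eq` uniqueness, so the default value
`0` is not used. -/
theorem firstChernClass_eq {h : HermitianMetric E K} (hC : C.IsHermitian h) {Ω : CForm E M 2}
    (hΩ : C.IsCurvatureForm Ω) {Φ : ClosedForm E M}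
    (hΦ : EqChernMultiple (Φ : Form E M 2) Ω) : firstChernClass E K = deRhamClass Φ := by
  have hex : IsFirstChernClass E K (deRhamClass Φ) := ⟨h, C, Ω, Φ, hC, hΩ, hΦ, rfl⟩
  have huniq : ∃! c, IsFirstChernClass E K c := by
    refine ⟨_, hex, ?_⟩
    rintro c ⟨h', C', Ω', Φ', -, hΩ', hΦ', rfl⟩
    exact hΩ.deRhamClass_eq hΩ' hΦ hΦ'
  rw [firstChernClass, dif_pos huniq]
  exact huniq.unique huniq.choose_spec.1 hex

variable (P : TwistedPoissonStructure E M)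

theorem sharpForm_mem_closedBivector (Φ : ClosedForm E M) :
    sharpForm P.Λ 2 (Φ : Form E M 2) ∈ P.ClosedBivector := by
  refine LinearMap.mem_ker.2 (funext fun a => ?_)
  have h := koszulDiff_signedPullback (sharp P.Λ) (ρ' := P.anchor) (fun _ => rfl)
    P.sharp_bracketφ 1 (Φ : Form E M 2) a
  rw [LinearMap.mem_ker.1 Φ.2, Pi.zero_apply, mul_zero] at h
  exact h

theorem sharpCohomology_deRhamClass (Φ : ClosedForm E M) :
    P.sharpCohomology (deRhamClass Φ) = P.cls ⟨_, sharpForm_mem_closedBivector P Φ⟩ := rfl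

theorem IsPurelyImaginary.compLinearMap {L L' : Type*} [AddCommGroup L] [Module (Fun E M) L]
    [AddCommGroup L'] [Module (Fun E M) L'] {Ω : L [⋀^Fin 2]→ₗ[Fun E M] CFun E M}
    (h : IsPurelyImaginary Ω) (T : L' →ₗ[Fun E M] L) : IsPurelyImaginary (Ω.compLinearMap T) :=
  fun a x => h (fun i => T (a i)) x

theorem EqChernMultiple.sharpForm {Φ : Form E M 2} {Ω : CForm E M 2} (h : EqChernMultiple Φ Ω) :
    EqChernMultiple (sharpForm P.Λ 2 Φ) (Ω.compLinearMap (sharp P.Λ)) := by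
  intro a x
  have h2 : TwistedPoisson.sharpForm P.Λ 2 Φ a = Φ (fun i => sharp P.Λ (a i)) := by
    rw [TwistedPoisson.sharpForm, signedPullback_apply, neg_one_sq, one_mul]
  rw [h2]
  exact h _ x

/-- The twisted Poisson condition enters here, through the compatibility of `Λ^♯` with brackets. -/
theorem Connection.contravariant_curvature (C : Connection E K) (α β : OneForm E M) :
    (C.contravariant P).curvature α β = C.curvature (sharp P.Λ α) (sharp P.Λ β) := by
  change C.nabla _ * C.nabla _ - C.nabla _ * C.nabla _ - C.nabla (sharp P.Λ (P.bracketφ α β)) = _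
  rw [P.sharp_bracketφ]; rfl

theorem Connection.IsCurvatureForm.isCurvatureBivector {Ω : CForm E M 2}
    (hΩ : C.IsCurvatureForm Ω) :
    (C.contravariant P).IsCurvatureBivector (Ω.compLinearMap (sharp P.Λ)) := by
  intro α β s x
  rw [C.contravariant_curvature, hΩ, AlternatingMap.compLinearMap_apply]
  congr 3
  funext i
  fin_cases i <;> rfl

theorem ContravariantDerivative.IsCurvatureBivector.unique {P : TwistedPoissonStructure E M}
    {D : ContravariantDerivative E K P} {Pi Pi' : CMultiVector E M 2}
    (h : D.IsCurvatureBivector Pi) (h' : D.IsCurvatureBivector Pi') : Pi = Pi' := by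
  refine AlternatingMap.ext fun a => cfun_ext K fun s => ?_
  ext x
  rw [eq_vec_two a, cmul_apply, cmul_apply, ← h, ← h']

end ChernClass

end TwistedPoisson

end

theorem mainTheorem2
    {E : Type*} [NormedAddCommGroup E] [NormedSpace ℝ E] [FiniteDimensional ℝ E]
    {M : Type*} [TopologicalSpace M] [T2Space M] [ChartedSpace E M]
    [IsManifold 𝓘(ℝ, E) ∞ M]
    {K : M → Type*} [TopologicalSpace (Bundle.TotalSpace ℂ K)] [∀ x, AddCommGroup (K x)]
    [∀ x, Module ℂ (K x)] [∀ x, TopologicalSpace (K x)] [FiberBundle ℂ K]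
    [VectorBundle ℂ ℂ K] [VectorBundle ℝ ℂ K]
    [ContMDiffVectorBundle ∞ ℂ K 𝓘(ℝ, E)]
    (P : TwistedPoisson.TwistedPoissonStructure E M)
    (h : TwistedPoisson.HermitianMetric E K) (C : TwistedPoisson.Connection E K)
    (hC : C.IsHermitian h) :
    (C.contravariant P).IsHermitian h ∧
    (∃ Pi : TwistedPoisson.CMultiVector E M 2, (C.contravariant P).IsCurvatureBivector Pi) ∧
    ∀ Pi : TwistedPoisson.CMultiVector E M 2, (C.contravariant P).IsCurvatureBivector Pi →
      TwistedPoisson.IsPurelyImaginary Pi ∧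
      ∃ R : P.ClosedBivector,
        TwistedPoisson.EqChernMultiple (R : TwistedPoisson.MultiVector E M 2) Pi ∧
        P.sharpCohomology (TwistedPoisson.firstChernClass E K) = P.cls R := by
  have hΩ := C.isCurvatureForm_curvatureForm
  have him := hΩ.isPurelyImaginary hC
  obtain ⟨Φ, hΦ⟩ : ∃ Φ : TwistedPoisson.ClosedForm E M,
      TwistedPoisson.EqChernMultiple (Φ : TwistedPoisson.Form E M 2) C.curvatureForm :=
    have hΦ := TwistedPoisson.eqChernMultiple_compAlternatingMap him
    ⟨⟨_, LinearMap.mem_ker.2 (hΩ.deRhamDiff_eq_zero hΦ)⟩, hΦ⟩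
  refine ⟨fun α s t => hC _ s t, ⟨_, hΩ.isCurvatureBivector P⟩, fun Pi hPi => ?_⟩
  -- By uniqueness `Π` may be taken to be the pullback of the curvature form by `Λ^♯`.
  rw [hPi.unique (hΩ.isCurvatureBivector P)]
  refine ⟨him.compLinearMap (TwistedPoisson.sharp P.Λ), ?_⟩
  refine ⟨⟨TwistedPoisson.sharpForm P.Λ 2 Φ, TwistedPoisson.sharpForm_mem_closedBivector P Φ⟩,
    hΦ.sharpForm P, ?_⟩
  rw [TwistedPoisson.firstChernClass_eq hC hΩ hΦ, TwistedPoisson.sharpCohomology_deRhamClass]
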